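/- Consider a chain of $N\ge 2$ particles of mass $m>0$ with nearest-neighbour springs of frequency $\omega_0>0$, whose two end particles are damped, with constants $\eta_L,\eta_R>0$, by independent ohmic quantum reservoirs at temperatures $T_L,T_R>0$ (infinite cutoff). In Fourier space (convention $\tilde x(\omega)=\int x(t)e^{i\omega t}dt$) the quantum Langevin equations read $Z(\omega)\tilde X(\omega)=\tilde F(\omega)$, where $\tilde F=(\tilde F_L,0,\dots,0,\tilde F_R)$ and $Z(\omega)$ is the tridiagonal $N\times N$ matrix $$Z(\omega)_{jj}=-m\omega^2-i\omega\,\eta_j+m\omega_0^2\,d_j,\qquad Z(\omega)_{j,j\pm1}=-m\omega_0^2,$$ with $\eta_1=\eta_L$, $\eta_N=\eta_R$, $\eta_j=0$ otherwise, and $d_1=d_N=1$, $d_j=2$ otherwise. The forces are uncorrelated with each other and have spectral densities $S_a(\omega)=\eta_a\hbar\omega\coth\frac{\hbar\omega}{2k_BT_a}$, $a=L,R$. With $G=Z^{-1}$, the stationary heat flux out of the left reservoir, i.e. the stationary value of $\frac12\langle\{\dot X_1,F_L\}\rangle-\eta_L\langle\dot X_1^2\rangle$, is $$J_E(T_L,T_R)=\int_{-\infty}^{\infty}\frac{d\omega}{2\pi}\Big[\operatorname{Re}\big(-i\omega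 G_{11}(\omega)\big)S_L(\omega)-\eta_L\omega^2\big(|G_{11}(\omega)|^2S_L(\omega)+|G_{1N}(\omega)|^2S_R(\omega)\big)\Big].$$ Put $\alpha_{L}=\eta_{L}/2m\omega_0$, $\alpha_{R}=\eta_{R}/2m\omega_0$, $T_D=2\hbar\omega_0/k_B$ and, for $T>0$, $\Theta=T/T_D$. Then: (i) the integrand of $J_E(T_L,T_R)$ is absolutely integrable for all $T_L,T_R>0$; (ii) for every $T>0$ the thermal conductance $$\mathcal K=\lim_{\Delta T\to0}\frac{J_E(T-\Delta T/2,\;T+\Delta T/2)}{-\Delta T}$$ exists (here $\Delta T=T_R-T_L$ and $J_E$ is counted from left to right); (iii) it equals $$\mathcal K=\frac{k_B^2T_D}{2\pi\hbar}\,\frac{\alpha_L\alpha_R}{\Theta^2}\int_{\mathcal C}d\theta\,\frac{\sin^2\frac\theta2\cos^3\frac\theta2\,\operatorname{csch}^2\!\big[\frac1{2\Theta}\sin\frac\theta2\big]}{\big[\sin(N\theta)+4\alpha_L\alpha_R\sin((N-1)\theta)\big]^2+4(\alpha_L+\alpha_R)^2\cos^2((N-\frac12)\theta)},$$ an absolutely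 convergent integral, for each of the four polygonal contours $\mathcal C$ running from $-\pi\pm i\infty$ vertically to $-\pi$, along the real axis to $\pi$, and vertically to $\pi\pm i\infty$ (the two signs being chosen independently); (iv) the dimensionless conductance $\widetilde{\mathcal K}=\pi\hbar\mathcal K/k_B^2T_D$ is the following sum of two absolutely convergent real integrals: $$\widetilde{\mathcal K}=\frac{\alpha_L\alpha_R}{\Theta^2}\left[\int_0^\pi d\varphi\,\frac{\sin^2\frac\varphi2\cos^3\frac\varphi2\,\operatorname{csch}^2\!\big[\frac1{2\Theta}\sin\frac\varphi2\big]}{\big[\sin(N\varphi)+4\alpha_L\alpha_R\sin((N-1)\varphi)\big]^2+4(\alpha_L+\alpha_R)^2\cos^2((N-\frac12)\varphi)}\right.$$ $$\left.+\int_0^\infty d\xi\,\frac{\sinh^3\frac\xi2\cosh^2\frac\xi2\,\operatorname{csch}^2\!\big[\frac1{2\Theta}\cosh\frac\xi2\big]}{\big[\sinh(N\xi)-4\alpha_L\alpha_R\sinh((N-1)\xi)\big]^2+4(\alpha_L+\alpha_R)^2\sinh^2((N-\frac12)\xi)}\right].$$ -/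

import Mathlib

open Filter Topology MeasureTheory

noncomputable section

namespace HeatChain

/-- Physical data: a chain of `N ≥ 2` particles of mass `m`, nearest neighbours coupled by springs of
frequency `ω₀`, the end particles being damped with constants `ηL`, `ηR` by two reservoirs;
`ħ` and `kB` are the Planck and Boltzmann constants. -/
structure Chain where
  N : ℕ
  m : ℝ
  ω₀ : ℝ
  ηL : ℝ
  ηR : ℝ
  ħ : ℝ
  kB : ℝ
  two_le_N : 2 ≤ N
  m_pos : 0 < m
  ω₀_pos : 0 < ω₀
  ηL_pos : 0 < ηL
  ηR_pos : 0 < ηR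
  ħ_pos : 0 < ħ
  kB_pos : 0 < kB

namespace Chain

variable (c : Chain)

/-- Left end particle. -/
def left : Fin c.N := ⟨0, by have := c.two_le_N; omega⟩

/-- Right end particle. -/
def right : Fin c.N := ⟨c.N - 1, by have := c.two_le_N; omega⟩

/-- Dimensionless damping constants `α_a = η_a / (2 m ω₀)`. -/
def αL : ℝ := c.ηL / (2 * c.m * c.ω₀)

def αR : ℝ := c.ηR / (2 * c.m * c.ω₀)

/-- Debye temperature `T_D = 2 ħ ω₀ / k_B`. -/
def debyeTemp : ℝ := 2 * c.ħ * c.ω₀ / c.kB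

/-- Reduced temperature `Θ = T / T_D`. -/
def reducedTemp (T : ℝ) : ℝ := T / c.debyeTemp

/-- Damping constant acting on particle `i`: it is nonzero only at the two ends. -/
def damping (i : Fin c.N) : ℝ :=
  if i = c.left then c.ηL else if i = c.right then c.ηR else 0

/-- Number of springs attached to particle `i`. -/
def springs (i : Fin c.N) : ℝ :=
  (if i = c.left then 0 else 1) + (if i = c.right then 0 else 1)

/-- The matrix `Z(ω)` for which the Fourier transform (convention `x̃(ω) = ∫ x(t) e^{iωt} dt`) of the
quantum Langevin equations
`m Ẍ_j + η_j Ẋ_j + m ω₀² ∑_{k neighbour of j} (X_j - X_k) = F_j`,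
with `F_1 = F_L`, `F_N = F_R` and `F_j = 0` otherwise, reads `Z(ω) X̃(ω) = F̃(ω)`. -/
def langevinMatrix (ω : ℝ) : Matrix (Fin c.N) (Fin c.N) ℂ := fun i j =>
  if i = j then
    -((c.m * ω ^ 2 : ℝ) : ℂ) - Complex.I * ((ω * c.damping i : ℝ) : ℂ)
      + ((c.m * c.ω₀ ^ 2 * c.springs i : ℝ) : ℂ)
  else if (i : ℕ) + 1 = (j : ℕ) ∨ (j : ℕ) + 1 = (i : ℕ) then -((c.m * c.ω₀ ^ 2 : ℝ) : ℂ)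
  else 0

/-- Response of the displacements to the forces, `X̃(ω) = G(ω) F̃(ω)`. -/
def green (ω : ℝ) : Matrix (Fin c.N) (Fin c.N) ℂ := (c.langevinMatrix ω)⁻¹

/-- Spectral density `η ħ ω coth(ħω / 2 k_B T)` of the fluctuating force of a reservoir with
damping constant `η` and temperature `T`:
`½⟨{F(t), F(t')}⟩ = ∫ S(ω) e^{-iω(t'-t)} dω / 2π`. -/
def noiseSpectrum (η T ω : ℝ) : ℝ :=
  η * c.ħ * ω *
    (Real.cosh (c.ħ * ω / (2 * c.kB * T)) / Real.sinh (c.ħ * ω / (2 * c.kB * T)))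

/-- Spectral density of the power `½⟨{Ẋ₁, F_L}⟩ - η_L ⟨Ẋ₁²⟩` in the stationary state, for
independent reservoirs at temperatures `TL` and `TR`. -/
def heatFluxDensity (TL TR ω : ℝ) : ℝ :=
  (-Complex.I * (ω : ℂ) * c.green ω c.left c.left).re * c.noiseSpectrum c.ηL TL ω
    - c.ηL * (ω ^ 2 * (‖c.green ω c.left c.left‖ ^ 2 * c.noiseSpectrum c.ηL TL ω
        + ‖c.green ω c.left c.right‖ ^ 2 * c.noiseSpectrum c.ηR TR ω))

/-- Stationary heat flux `J_E` from the left reservoir into the chain (and so to the right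
reservoir). -/
def heatFlux (TL TR : ℝ) : ℝ :=
  (2 * Real.pi)⁻¹ * ∫ ω : ℝ, c.heatFluxDensity TL TR ω

/-- Integrand of the contour representation of the conductance at mean temperature `T`, a function
of the complex variable `θ` related to the frequency by `ω = 2 ω₀ sin (θ/2)`. -/
def thetaIntegrand (T : ℝ) (θ : ℂ) : ℂ :=
  Complex.sin (θ / 2) ^ 2 * Complex.cos (θ / 2) ^ 3
      * (Complex.sinh (1 / (2 * (c.reducedTemp T : ℂ)) * Complex.sin (θ / 2)))⁻¹ ^ 2
    / ((Complex.sin ((c.N : ℂ) * θ)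
          + 4 * (c.αL : ℂ) * (c.αR : ℂ) * Complex.sin (((c.N : ℂ) - 1) * θ)) ^ 2
        + 4 * ((c.αL : ℂ) + (c.αR : ℂ)) ^ 2 * Complex.cos (((c.N : ℂ) - 1 / 2) * θ) ^ 2)

/-- First real integrand (propagating frequencies `|ω| ≤ 2ω₀`, `θ = φ ∈ [0, π]`). -/
def bandIntegrand (T φ : ℝ) : ℝ :=
  Real.sin (φ / 2) ^ 2 * Real.cos (φ / 2) ^ 3
      * (Real.sinh (1 / (2 * c.reducedTemp T) * Real.sin (φ / 2)))⁻¹ ^ 2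
    / ((Real.sin ((c.N : ℝ) * φ) + 4 * c.αL * c.αR * Real.sin (((c.N : ℝ) - 1) * φ)) ^ 2
        + 4 * (c.αL + c.αR) ^ 2 * Real.cos (((c.N : ℝ) - 1 / 2) * φ) ^ 2)

/-- Second real integrand (the branch cut `|ω| > 2ω₀`, parametrized by `ξ ∈ [0, ∞)`). -/
def cutIntegrand (T ξ : ℝ) : ℝ :=
  Real.sinh (ξ / 2) ^ 3 * Real.cosh (ξ / 2) ^ 2
      * (Real.sinh (1 / (2 * c.reducedTemp T) * Real.cosh (ξ / 2)))⁻¹ ^ 2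
    / ((Real.sinh ((c.N : ℝ) * ξ) - 4 * c.αL * c.αR * Real.sinh (((c.N : ℝ) - 1) * ξ)) ^ 2
        + 4 * (c.αL + c.αR) ^ 2 * Real.sinh (((c.N : ℝ) - 1 / 2) * ξ) ^ 2)

end Chain

/-- Absolute integrability of `f` along the contour that comes from `-π + i s ∞` straight to `-π`,
follows the real axis to `π`, and leaves straight to `π + i s' ∞`. Here `s, s' ∈ {1, -1}` select
the preimages of the two branch cuts. -/
def ContourIntegrable (s s' : ℝ) (f : ℂ → ℂ) : Prop :=
  IntegrableOn (fun ξ : ℝ => f (-(Real.pi : ℂ) + Complex.I * ((s * ξ : ℝ) : ℂ))) (Set.Ioi 0) ∧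
  IntervalIntegrable (fun φ : ℝ => f (φ : ℂ)) volume (-Real.pi) Real.pi ∧
  IntegrableOn (fun ξ : ℝ => f ((Real.pi : ℂ) + Complex.I * ((s' * ξ : ℝ) : ℂ))) (Set.Ioi 0)

/-- Integral of `f` along the same contour: `dθ = i s dξ` on the left arm (traversed from `ξ = ∞`
to `ξ = 0`), `dθ = dφ` on the real segment and `dθ = i s' dξ` on the right arm. -/
def contourIntegral (s s' : ℝ) (f : ℂ → ℂ) : ℂ :=
  -(∫ ξ in Set.Ioi (0 : ℝ),
      f (-(Real.pi : ℂ) + Complex.I * ((s * ξ : ℝ) : ℂ)) * (Complex.I * (s : ℂ)))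
    + (∫ φ in (-Real.pi)..Real.pi, f (φ : ℂ))
    + ∫ ξ in Set.Ioi (0 : ℝ),
      f ((Real.pi : ℂ) + Complex.I * ((s' * ξ : ℝ) : ℂ)) * (Complex.I * (s' : ℂ))

end HeatChain

end

namespace HeatChain

namespace Chain

open Matrix

variable (c : Chain)

/-! The anti-Hermitian part of `Z(ω)` is diagonal and sits on the two ends. Testing the quadratic
form of `Z` on a column of `G` gives the energy balance `im_green_left_left`, which cancels the
`|G₁₁|²` terms in the flux density. What remains is a Landauer form: `transmission` = `ω²|G_{1N}|²`
times the difference of the two factors `ω coth(ħω/2k_BT)`.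

Two estimates then give integrability and differentiation under the integral sign. The transmission
is `O(1/(1+ω²))` (`integrable_transmission`), and the temperature derivative of `ω coth` is at most
`2k_B/ħ`, uniformly in `ω` and `T` (`thermalWeight_le`). The limit is `tendsto_heatFlux_div`.

For the closed form, put `ω = 2ω₀ sin(θ/2)`. An explicit combination of sines solves every row of `Z
X = F` except the last, whose residue is a multiple of `resonance`; this yields `G_{1N}`
(`green_left_right`). Real `θ` covers the band `|ω| < 2ω₀`, and `θ = π + iξ` covers the frequencies
above it. On both lines `|resonance|²` is the stated denominator, so two changes of variable produce
the two real integrals (`integral_conductanceDensity`).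

The contour formula follows by parity: the real segment counts the band twice, and each vertical arm
contributes the cut integral once. The choice of arm enters only through `s² = 1`
(`contourIntegral_thetaIntegrand`). -/

/-! ### The Langevin matrix: symmetry, dissipation, invertibility, energy balance -/

lemma left_ne_right : c.left ≠ c.right := by
  have := c.two_le_N
  simp only [left, right, ne_eq, Fin.mk.injEq]
  omega

lemma damping_left : c.damping c.left = c.ηL := by simp [damping]

lemma damping_right : c.damping c.right = c.ηR := by
  simp [damping, c.left_ne_right.symm]

/-- A matrix-vector product with the tridiagonal matrix `Z(ω)`, row by row. -/
lemma langevinMatrix_mulVec (ω : ℝ) (f : ℕ → ℂ) (i : Fin c.N) :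
    (c.langevinMatrix ω *ᵥ fun j : Fin c.N => f j) i =
      (-((c.m * ω ^ 2 : ℝ) : ℂ) - Complex.I * ((ω * c.damping i : ℝ) : ℂ)
        + ((c.m * c.ω₀ ^ 2 * c.springs i : ℝ) : ℂ)) * f i
      - (if 0 < (i : ℕ) then ((c.m * c.ω₀ ^ 2 : ℝ) : ℂ) * f (i - 1) else 0)
      - (if (i : ℕ) + 1 < c.N then ((c.m * c.ω₀ ^ 2 : ℝ) : ℂ) * f (i + 1) else 0) := by
  set d : ℂ := -((c.m * ω ^ 2 : ℝ) : ℂ) - Complex.I * ((ω * c.damping i : ℝ) : ℂ)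
        + ((c.m * c.ω₀ ^ 2 * c.springs i : ℝ) : ℂ) with hd
  set k : ℂ := ((c.m * c.ω₀ ^ 2 : ℝ) : ℂ) with hk
  -- The guard `0 < i` is needed because truncated subtraction would make `i - 1` coincide with `i`
  -- at the left end.
  set g : ℕ → ℂ := fun n => (if n = (i : ℕ) then d * f n else 0)
        - (if 0 < (i : ℕ) then (if n = (i : ℕ) - 1 then k * f n else 0) else 0)
        - (if n = (i : ℕ) + 1 then k * f n else 0) with hg
  have key : ∀ j : Fin c.N, c.langevinMatrix ω i j * f j = g j := by
    intro j
    simp only [langevinMatrix, ← hd, ← hk, Fin.ext_iff, hg]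
    rcases lt_trichotomy (i : ℕ) (j : ℕ) with h | h | h
    · by_cases h' : (i : ℕ) + 1 = j
      · rw [if_neg h.ne, if_pos (Or.inl h'), if_neg h.ne', if_pos h'.symm,
          if_neg (c := (j : ℕ) = i - 1) (by omega)]
        simp
      · rw [if_neg h.ne, if_neg (by omega), if_neg h.ne', if_neg (Ne.symm h'),
          if_neg (c := (j : ℕ) = i - 1) (by omega)]
        simp
    · rw [if_pos h, if_pos h.symm, if_neg (c := (j : ℕ) = i + 1) (by omega)]
      by_cases h0 : 0 < (i : ℕ)
      · rw [if_neg (c := (j : ℕ) = i - 1) (by omega)]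
        simp
      · simp [h0]
    · rw [if_neg h.ne', if_neg h.ne, if_pos (by omega : 0 < (i : ℕ)),
        if_neg (c := (j : ℕ) = i + 1) (by omega)]
      by_cases h' : (j : ℕ) + 1 = i
      · rw [if_pos (Or.inr h'), if_pos (by omega)]
        simp
      · rw [if_neg (by omega), if_neg (by omega)]
        simp
  have hi := i.isLt
  simp only [Matrix.mulVec, dotProduct]
  rw [Finset.sum_congr rfl fun j _ => key j, Fin.sum_univ_eq_sum_range g, hg,
    Finset.sum_sub_distrib, Finset.sum_sub_distrib]
  congr 1
  · congr 1
    · simp [hi]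
    · by_cases h0 : 0 < (i : ℕ)
      · simp [h0, show (i : ℕ) - 1 < c.N by omega]
      · simp [h0]
  · simp

lemma langevinMatrix_transpose (ω : ℝ) : (c.langevinMatrix ω)ᵀ = c.langevinMatrix ω := by
  ext i j
  simp only [transpose_apply, langevinMatrix]
  by_cases h : i = j
  · subst h; rfl
  · rw [if_neg h, if_neg (Ne.symm h)]
    simp only [or_comm]

lemma langevinMatrix_conjTranspose (ω : ℝ) :
    (c.langevinMatrix ω)ᴴ = c.langevinMatrix (-ω) := by
  rw [conjTranspose, langevinMatrix_transpose]
  ext i j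
  simp only [map_apply, langevinMatrix]
  split_ifs <;> simp

/-- The dissipative part of `Z(ω)` sits on the diagonal. -/
lemma im_star_dotProduct_langevinMatrix_mulVec (ω : ℝ) (v : Fin c.N → ℂ) :
    (star v ⬝ᵥ c.langevinMatrix ω *ᵥ v).im =
      -(ω * (c.ηL * ‖v c.left‖ ^ 2 + c.ηR * ‖v c.right‖ ^ 2)) := by
  set D : Matrix (Fin c.N) (Fin c.N) ℂ :=
    Matrix.diagonal fun i => Complex.I * ((ω * c.damping i : ℝ) : ℂ) with hD
  have hR : (c.langevinMatrix ω + D).IsHermitian := by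
    rw [IsHermitian, conjTranspose_add, langevinMatrix_conjTranspose]
    ext i j
    by_cases h : i = j
    · subst h
      simp [hD, langevinMatrix]
      ring
    · simp [hD, langevinMatrix, h]
  have h1 := hR.im_star_dotProduct_mulVec_self v
  rw [add_mulVec, dotProduct_add] at h1
  have h2 : (star v ⬝ᵥ D *ᵥ v).im =
      ω * (c.ηL * ‖v c.left‖ ^ 2 + c.ηR * ‖v c.right‖ ^ 2) := by
    simp only [dotProduct, hD, mulVec_diagonal, Pi.star_apply, Complex.im_sum]
    have : ∀ i, (star (v i) * (Complex.I * ((ω * c.damping i : ℝ) : ℂ) * v i)).im =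
        ω * ((if i = c.left then c.ηL * ‖v c.left‖ ^ 2 else 0)
          + if i = c.right then c.ηR * ‖v c.right‖ ^ 2 else 0) := by
      intro i
      have e : star (v i) * (Complex.I * ((ω * c.damping i : ℝ) : ℂ) * v i) =
          Complex.I * ((ω * c.damping i * ‖v i‖ ^ 2 : ℝ) : ℂ) := by
        have := Complex.conj_mul' (v i)
        simp only [Complex.star_def]
        push_cast
        linear_combination (Complex.I * (ω * c.damping i)) * this
      rw [e, Complex.I_mul_im, Complex.ofReal_re]
      by_cases hl : i = c.left
      · subst hl
        simp [damping_left, c.left_ne_right]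
        ring
      · by_cases hr : i = c.right
        · subst hr
          simp [damping_right, c.left_ne_right.symm]
          ring
        · simp [damping, hl, hr]
    rw [Finset.sum_congr rfl fun i _ => this i, ← Finset.mul_sum, Finset.sum_add_distrib]
    simp
  simp only [RCLike.im_to_complex, Complex.add_im] at h1
  linarith

/-- Dissipation forces a kernel vector to vanish at the left end; row `n` of the three-term
recursion then propagates the zero to site `n + 1`. At `ω = 0` this fails: uniform translations are
in the kernel. -/
lemma langevinMatrix_mulVec_eq_zero {ω : ℝ} (hω : ω ≠ 0) {v : Fin c.N → ℂ}
    (hv : c.langevinMatrix ω *ᵥ v = 0) : v = 0 := by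
  have h0 : v c.left = 0 := by
    have h := c.im_star_dotProduct_langevinMatrix_mulVec ω v
    rw [hv, dotProduct_zero, Complex.zero_im, eq_comm, neg_eq_zero, mul_eq_zero,
      or_iff_right hω] at h
    have h1 := mul_nonneg c.ηL_pos.le (sq_nonneg ‖v c.left‖)
    have h2 := mul_nonneg c.ηR_pos.le (sq_nonneg ‖v c.right‖)
    have h3 : c.ηL * ‖v c.left‖ ^ 2 = 0 := by linarith
    simpa [c.ηL_pos.ne'] using h3
  set f : ℕ → ℂ := fun n => if h : n < c.N then v ⟨n, h⟩ else 0 with hf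
  have hvf : v = fun j : Fin c.N => f j := by
    ext j
    simp [hf]
  have hk : ((c.m * c.ω₀ ^ 2 : ℝ) : ℂ) ≠ 0 := by
    have := c.m_pos; have := c.ω₀_pos
    exact_mod_cast (by positivity : c.m * c.ω₀ ^ 2 ≠ 0)
  have hrec : ∀ n, n < c.N → f n = 0 := by
    intro n
    induction n using Nat.strong_induction_on with
    | _ n ih =>
      intro hn
      rcases n with _ | n
      · simpa [hf, left, show 0 < c.N from hn] using h0
      · have h := congrFun hv ⟨n, by omega⟩
        rw [hvf, langevinMatrix_mulVec] at h
        simp only [ih n (by omega) (by omega), mul_zero, zero_sub, Pi.zero_apply, hn,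
          if_true] at h
        have h' : (if 0 < n then ((c.m * c.ω₀ ^ 2 : ℝ) : ℂ) * f (n - 1) else 0) = 0 := by
          split_ifs with h0
          · rw [ih (n - 1) (by omega) (by omega), mul_zero]
          · rfl
        rw [h', neg_zero, zero_sub, neg_eq_zero, mul_eq_zero, or_iff_right hk] at h
        exact h
  rw [hvf]
  ext j
  exact hrec j j.isLt

lemma isUnit_det_langevinMatrix {ω : ℝ} (hω : ω ≠ 0) : IsUnit (c.langevinMatrix ω).det := by
  rw [isUnit_iff_ne_zero]
  intro h
  obtain ⟨v, hv0, hv⟩ := exists_mulVec_eq_zero_iff.2 h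
  exact hv0 (c.langevinMatrix_mulVec_eq_zero hω hv)

lemma green_comm (ω : ℝ) (i j : Fin c.N) : c.green ω i j = c.green ω j i := by
  rw [← transpose_apply (c.green ω), green, transpose_nonsing_inv, langevinMatrix_transpose]

lemma green_neg (ω : ℝ) (i j : Fin c.N) : c.green (-ω) i j = star (c.green ω i j) := by
  rw [green, ← langevinMatrix_conjTranspose, ← conjTranspose_nonsing_inv, conjTranspose_apply,
    ← green, green_comm]

/-- Energy balance: the power absorbed at the left end is dissipated at the two ends. -/
lemma im_green_left_left {ω : ℝ} (hω : ω ≠ 0) :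
    (c.green ω c.left c.left).im =
      ω * (c.ηL * ‖c.green ω c.left c.left‖ ^ 2 + c.ηR * ‖c.green ω c.left c.right‖ ^ 2) := by
  -- The left column `g` of `G` satisfies `Z g = e_left`, so the quadratic form at `g` is the
  -- conjugate of `G₁₁`.
  have h := c.im_star_dotProduct_langevinMatrix_mulVec ω (fun i => c.green ω i c.left)
  have h1 : c.langevinMatrix ω *ᵥ (fun i => c.green ω i c.left) = Pi.single c.left 1 := by
    have := Matrix.mul_nonsing_inv _ (c.isUnit_det_langevinMatrix hω)
    ext i
    have := congrFun (congrFun this i) c.left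
    rw [Matrix.mul_apply] at this
    simp only [mulVec, dotProduct, green, this, Matrix.one_apply, Pi.single_apply]
  rw [h1, dotProduct_single] at h
  simp only [Pi.star_apply, Complex.star_def, mul_one, Complex.conj_im, neg_inj] at h
  rw [h, c.green_comm ω c.right c.left]

lemma heatFluxDensity_eq (TL TR : ℝ) {ω : ℝ} (hω : ω ≠ 0) :
    c.heatFluxDensity TL TR ω = ω ^ 2 * ‖c.green ω c.left c.right‖ ^ 2 *
      (c.ηR * c.noiseSpectrum c.ηL TL ω - c.ηL * c.noiseSpectrum c.ηR TR ω) := by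
  have h : (-Complex.I * (ω : ℂ) * c.green ω c.left c.left).re =
      ω * (c.green ω c.left c.left).im := by
    simp
  rw [heatFluxDensity, h, c.im_green_left_left hω]
  ring

/-- Cramer's rule gives measurability at once, including at the singular frequency `ω = 0`. -/
lemma measurable_green (i j : Fin c.N) : Measurable fun ω => c.green ω i j := by
  have hZ : Continuous c.langevinMatrix := by
    refine continuous_matrix fun i j => ?_
    simp only [langevinMatrix]
    split_ifs <;> fun_prop
  have h : (fun ω => c.green ω i j) = fun ω =>
      (c.langevinMatrix ω).det⁻¹ * (c.langevinMatrix ω).adjugate i j := by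
    ext ω
    rw [green, Matrix.inv_def, Ring.inverse_eq_inv', Matrix.smul_apply, smul_eq_mul]
  rw [h]
  exact hZ.matrix_det.measurable.inv.mul (hZ.matrix_adjugate.matrix_elem i j).measurable

/-! ### The end-to-end response in closed form -/

lemma αL_pos : 0 < c.αL := by
  have := c.m_pos; have := c.ω₀_pos; have := c.ηL_pos
  unfold αL; positivity

lemma αR_pos : 0 < c.αR := by
  have := c.m_pos; have := c.ω₀_pos; have := c.ηR_pos
  unfold αR; positivity

lemma ηL_eq : c.ηL = 2 * c.m * c.ω₀ * c.αL := by
  have := c.m_pos; have := c.ω₀_pos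
  unfold αL; field_simp

lemma ηR_eq : c.ηR = 2 * c.m * c.ω₀ * c.αR := by
  have := c.m_pos; have := c.ω₀_pos
  unfold αR; field_simp

/-- The displacement profile solving the first `N - 1` rows of `Z(ω) X = F` for forcing at the
right end, where `ω = 2 ω₀ sin (θ / 2)`. -/
noncomputable def profile (θ : ℂ) (n : ℕ) : ℂ :=
  Complex.sin ((n + 1) * θ) - (1 + 4 * Complex.I * c.αL * Complex.sin (θ / 2)) * Complex.sin (n * θ)

/-- The factor of the determinant of `Z(ω)` that appears, squared, in the conductance formula. -/
noncomputable def resonance (θ : ℂ) : ℂ :=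
  Complex.sin ((c.N : ℂ) * θ) + 4 * c.αL * c.αR * Complex.sin (((c.N : ℂ) - 1) * θ)
    + 2 * Complex.I * (c.αL + c.αR) * Complex.cos (((c.N : ℂ) - 1 / 2) * θ)

lemma profile_add_two (θ : ℂ) (n : ℕ) :
    c.profile θ (n + 2) + c.profile θ n =
      (2 - 4 * Complex.sin (θ / 2) ^ 2) * c.profile θ (n + 1) := by
  have hc : (2 - 4 * Complex.sin (θ / 2) ^ 2 : ℂ) = 2 * Complex.cos θ := by
    have h1 := Complex.cos_two_mul (θ / 2)
    have h2 := Complex.sin_sq_add_cos_sq (θ / 2)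
    rw [show 2 * (θ / 2) = θ by ring] at h1
    rw [h1]
    linear_combination -4 * h2
  have key : ∀ x : ℂ, Complex.sin (x + θ) + Complex.sin (x - θ) =
      2 * Complex.cos θ * Complex.sin x := by
    intro x
    rw [Complex.sin_add, Complex.sin_sub]
    ring
  have h1 := key ((n + 2) * θ)
  have h2 := key ((n + 1) * θ)
  rw [show ((n : ℂ) + 2) * θ + θ = (n + 3) * θ by ring,
    show ((n : ℂ) + 2) * θ - θ = (n + 1) * θ by ring] at h1
  rw [show ((n : ℂ) + 1) * θ + θ = (n + 2) * θ by ring,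
    show ((n : ℂ) + 1) * θ - θ = n * θ by ring] at h2
  rw [hc]
  simp only [profile]
  push_cast
  rw [show ((n : ℂ) + 2 + 1) * θ = (n + 3) * θ by ring,
    show ((n : ℂ) + 1 + 1) * θ = (n + 2) * θ by ring]
  linear_combination h1 - (1 + 4 * Complex.I * c.αL * Complex.sin (θ / 2)) * h2

/-- The left row amounts to a ghost site with `X₀ = (1 + 4iα_L sin(θ/2)) X₁`, which `profile`
satisfies by construction. This is the defect in the mirror condition at the right end; it is what
makes `resonance` a factor of the determinant. -/
lemma profile_boundary (θ : ℂ) {n : ℕ} (hn : n + 1 = c.N) :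
    c.profile θ (n + 1) - (1 + 4 * Complex.I * c.αR * Complex.sin (θ / 2)) * c.profile θ n =
      -4 * Complex.sin (θ / 2) ^ 2 * c.resonance θ := by
  have hN : (c.N : ℂ) = n + 1 := by exact_mod_cast hn.symm
  simp only [profile, resonance, hN]
  push_cast
  -- With `θ = 2h` and `y = (2n+1)h` every angle is `y` plus an integer multiple of `h`, so the
  -- addition formulas reduce the claim to a polynomial identity.
  obtain ⟨h, rfl⟩ : ∃ h : ℂ, θ = 2 * h := ⟨θ / 2, by ring⟩
  set y : ℂ := (2 * n + 1) * h with hy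
  rw [show ((n : ℂ) + 1 + 1) * (2 * h) = y + (2 * h + h) by rw [hy]; ring,
    show ((n : ℂ) + 1) * (2 * h) = y + h by rw [hy]; ring,
    show ((n : ℂ) + 1 - 1) * (2 * h) = y - h by rw [hy]; ring,
    show (n : ℂ) * (2 * h) = y - h by rw [hy]; ring,
    show ((n : ℂ) + 1 - 1 / 2) * (2 * h) = y by rw [hy]; ring,
    show 2 * h / 2 = h by ring]
  simp only [Complex.sin_add, Complex.cos_add, Complex.sin_sub, Complex.sin_two_mul,
    Complex.cos_two_mul]
  have h2 : Complex.cos h ^ 2 = 1 - Complex.sin h ^ 2 := by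
    rw [← Complex.sin_sq_add_cos_sq h]; ring
  have h3 : Complex.cos h ^ 3 = (1 - Complex.sin h ^ 2) * Complex.cos h := by
    rw [← h2]; ring
  have hI : Complex.I ^ 2 = -1 := Complex.I_sq
  ring_nf
  simp only [h2, h3, hI]
  ring

lemma langevinMatrix_mulVec_profile {ω : ℝ} {θ : ℂ}
    (hω : (ω : ℂ) = 2 * c.ω₀ * Complex.sin (θ / 2)) :
    (c.langevinMatrix ω *ᵥ fun j : Fin c.N => c.profile θ j) =
      Pi.single c.right
        (c.m * c.ω₀ ^ 2 * (-4 * Complex.sin (θ / 2) ^ 2 * c.resonance θ)) := by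
  have hN := c.two_le_N
  ext i
  rw [langevinMatrix_mulVec]
  have hi := i.isLt
  push_cast
  rw [hω, Pi.single_apply]
  by_cases hl : i = c.left
  · have hi0 : (i : ℕ) = 0 := by rw [hl]; rfl
    rw [if_neg (by omega), if_pos (by omega), if_neg (by rw [hl]; exact c.left_ne_right), hi0, hl,
      damping_left, ηL_eq]
    have h1 := Complex.sin_two_mul θ
    have h2 := Complex.cos_two_mul (θ / 2)
    have h3 := Complex.sin_sq_add_cos_sq (θ / 2)
    rw [show 2 * (θ / 2) = θ by ring] at h2
    simp only [springs, profile, if_true, if_neg c.left_ne_right]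
    push_cast
    rw [show (1 + 1 : ℂ) * θ = 2 * θ by ring, h1, h2]
    simp only [zero_mul, zero_add, one_mul, Complex.sin_zero, mul_zero, sub_zero]
    linear_combination -4 * (c.m : ℂ) * c.ω₀ ^ 2 * Complex.sin θ * h3
  · have hi0 : (i : ℕ) ≠ 0 := fun h => hl (Fin.ext h)
    obtain ⟨n, hn⟩ := Nat.exists_eq_succ_of_ne_zero hi0
    have hrec := c.profile_add_two θ n
    rw [if_pos (by omega), hn, Nat.succ_sub_one]
    by_cases hr : i = c.right
    · have hiN : (i : ℕ) = c.N - 1 := by rw [hr]; rfl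
      have hb := c.profile_boundary θ (n := n + 1) (by omega)
      rw [if_neg (by omega), if_pos hr, hr, damping_right, ηR_eq]
      simp only [springs, if_neg c.left_ne_right.symm, if_true, Nat.succ_eq_add_one]
      push_cast
      rw [← hb]
      linear_combination -(c.m : ℂ) * c.ω₀ ^ 2 * hrec
    · have hiN : (i : ℕ) ≠ c.N - 1 := fun h => hr (Fin.ext h)
      rw [if_pos (by omega), if_neg hr]
      simp only [springs, damping, if_neg hl, if_neg hr, Nat.succ_eq_add_one]
      push_cast
      linear_combination -(c.m : ℂ) * c.ω₀ ^ 2 * hrec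

/-- The end-to-end response, in terms of the variable `θ` with `ω = 2 ω₀ sin (θ / 2)`. -/
lemma green_left_right {ω : ℝ} {θ : ℂ} (hω0 : ω ≠ 0)
    (hω : (ω : ℂ) = 2 * c.ω₀ * Complex.sin (θ / 2)) (hr : c.resonance θ ≠ 0) :
    c.green ω c.left c.right =
      Complex.sin θ / (-4 * c.m * c.ω₀ ^ 2 * Complex.sin (θ / 2) ^ 2 * c.resonance θ) := by
  have h := congrArg (fun v => (c.green ω *ᵥ v) c.left) (c.langevinMatrix_mulVec_profile hω)
  simp only [green] at h
  rw [mulVec_mulVec, Matrix.nonsing_inv_mul _ (c.isUnit_det_langevinMatrix hω0), one_mulVec,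
    mulVec_single] at h
  have hs : Complex.sin (θ / 2) ≠ 0 := by
    rintro h0
    rw [h0, mul_zero] at hω
    exact hω0 (by exact_mod_cast hω)
  have hm : (c.m : ℂ) ≠ 0 := by exact_mod_cast c.m_pos.ne'
  have hw : (c.ω₀ : ℂ) ≠ 0 := by exact_mod_cast c.ω₀_pos.ne'
  have hp : c.profile θ (c.left : Fin c.N) = Complex.sin θ := by
    simp [profile, left]
  rw [hp] at h
  rw [green, h]
  simp only [Pi.smul_apply, MulOpposite.smul_eq_mul_unop, MulOpposite.unop_op, Matrix.col_apply]
  field_simp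

/-- The squared end-to-end velocity response `ω² |G_{1N}(ω)|²`. -/
noncomputable def transmission (ω : ℝ) : ℝ := ω ^ 2 * ‖c.green ω c.left c.right‖ ^ 2

lemma transmission_neg (ω : ℝ) : c.transmission (-ω) = c.transmission ω := by
  rw [transmission, transmission, green_neg, norm_star, neg_sq]

lemma transmission_nonneg (ω : ℝ) : 0 ≤ c.transmission ω := by
  unfold transmission; positivity

lemma measurable_transmission : Measurable c.transmission :=
  (measurable_id.pow_const 2).mul ((c.measurable_green _ _).norm.pow_const 2)

lemma transmission_eq {ω : ℝ} {θ : ℂ} (hω0 : ω ≠ 0)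
    (hω : (ω : ℂ) = 2 * c.ω₀ * Complex.sin (θ / 2)) (hr : c.resonance θ ≠ 0) :
    c.transmission ω =
      ‖Complex.cos (θ / 2)‖ ^ 2 / (c.m ^ 2 * c.ω₀ ^ 2 * ‖c.resonance θ‖ ^ 2) := by
  have hm := c.m_pos
  have hw := c.ω₀_pos
  have hs : 0 < ‖Complex.sin (θ / 2)‖ := by
    rw [norm_pos_iff]
    rintro h0
    rw [h0, mul_zero] at hω
    exact hω0 (by exact_mod_cast hω)
  have hr' : 0 < ‖c.resonance θ‖ := norm_pos_iff.2 hr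
  have h1 : ω ^ 2 = 4 * c.ω₀ ^ 2 * ‖Complex.sin (θ / 2)‖ ^ 2 := by
    have := congrArg (fun z : ℂ => ‖z‖ ^ 2) hω
    simp only [norm_mul, Complex.norm_real, Real.norm_eq_abs, mul_pow, sq_abs] at this
    rw [this]
    norm_num
  have h2 : Complex.sin θ = 2 * Complex.sin (θ / 2) * Complex.cos (θ / 2) := by
    rw [← Complex.sin_two_mul]; congr 1; ring
  rw [transmission, c.green_left_right hω0 hω hr, h1, h2]
  simp only [norm_div, norm_mul, norm_neg, norm_pow, Complex.norm_real, Real.norm_eq_abs,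
    abs_of_pos hm, abs_of_pos hw, Complex.norm_ofNat]
  field_simp
  norm_num

/-! ### Denominators on the band and on the cut, with lower bounds -/

/-- Denominator of `bandIntegrand`. -/
noncomputable def bandDenominator (φ : ℝ) : ℝ :=
  (Real.sin ((c.N : ℝ) * φ) + 4 * c.αL * c.αR * Real.sin (((c.N : ℝ) - 1) * φ)) ^ 2
    + 4 * (c.αL + c.αR) ^ 2 * Real.cos (((c.N : ℝ) - 1 / 2) * φ) ^ 2

/-- Denominator of `cutIntegrand`. -/
noncomputable def cutDenominator (ξ : ℝ) : ℝ :=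
  (Real.sinh ((c.N : ℝ) * ξ) - 4 * c.αL * c.αR * Real.sinh (((c.N : ℝ) - 1) * ξ)) ^ 2
    + 4 * (c.αL + c.αR) ^ 2 * Real.sinh (((c.N : ℝ) - 1 / 2) * ξ) ^ 2

/-- For real angle the cosine term is the imaginary part of `resonance` and the sine terms are its
real part. -/
lemma norm_sq_resonance_ofReal (φ : ℝ) : ‖c.resonance φ‖ ^ 2 = c.bandDenominator φ := by
  have h : c.resonance φ =
      ((Real.sin ((c.N : ℝ) * φ) + 4 * c.αL * c.αR * Real.sin (((c.N : ℝ) - 1) * φ) : ℝ) : ℂ)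
      + ((2 * (c.αL + c.αR) * Real.cos (((c.N : ℝ) - 1 / 2) * φ) : ℝ) : ℂ) * Complex.I := by
    rw [resonance]
    push_cast
    ring
  rw [h, Complex.sq_norm, Complex.normSq_add_mul_I, bandDenominator]
  ring

lemma sin_nat_mul_pi_add (n : ℕ) (z : ℂ) :
    Complex.sin (n * Real.pi + z) = (-1) ^ n * Complex.sin z := by
  rw [add_comm]
  exact Complex.sin_antiperiodic.add_nat_mul_eq n

lemma cos_nat_mul_pi_add (n : ℕ) (z : ℂ) :
    Complex.cos (n * Real.pi + z) = (-1) ^ n * Complex.cos z := by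
  rw [add_comm]
  exact Complex.cos_antiperiodic.add_nat_mul_eq n

lemma sin_half_cut (x : ℝ) :
    Complex.sin (((Real.pi : ℂ) + Complex.I * (x : ℂ)) / 2) = (Real.cosh (x / 2) : ℂ) := by
  rw [show ((Real.pi : ℂ) + Complex.I * x) / 2 = ((x / 2 : ℝ) : ℂ) * Complex.I + Real.pi / 2 by
    push_cast; ring, Complex.sin_add_pi_div_two, Complex.cos_mul_I, Complex.ofReal_cosh]

lemma cos_half_cut (x : ℝ) :
    Complex.cos (((Real.pi : ℂ) + Complex.I * (x : ℂ)) / 2) =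
      -(Complex.I * (Real.sinh (x / 2) : ℂ)) := by
  rw [show ((Real.pi : ℂ) + Complex.I * x) / 2 = ((x / 2 : ℝ) : ℂ) * Complex.I + Real.pi / 2 by
    push_cast; ring, Complex.cos_add_pi_div_two, Complex.sin_mul_I, Complex.ofReal_sinh, mul_comm]

lemma sin_N_mul_cut (x : ℝ) :
    Complex.sin ((c.N : ℂ) * ((Real.pi : ℂ) + Complex.I * (x : ℂ))) =
      (-1) ^ c.N * (Complex.I * (Real.sinh ((c.N : ℝ) * x) : ℂ)) := by
  rw [show (c.N : ℂ) * ((Real.pi : ℂ) + Complex.I * x) =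
    (c.N : ℂ) * Real.pi + (((c.N : ℝ) * x : ℝ) : ℂ) * Complex.I by push_cast; ring,
    sin_nat_mul_pi_add, Complex.sin_mul_I, Complex.ofReal_sinh, mul_comm Complex.I]

lemma sin_N_sub_one_mul_cut (x : ℝ) :
    Complex.sin (((c.N : ℂ) - 1) * ((Real.pi : ℂ) + Complex.I * (x : ℂ))) =
      -((-1) ^ c.N * (Complex.I * (Real.sinh (((c.N : ℝ) - 1) * x) : ℂ))) := by
  rw [show ((c.N : ℂ) - 1) * ((Real.pi : ℂ) + Complex.I * x) =
    (c.N : ℂ) * Real.pi + ((((c.N : ℝ) - 1) * x : ℝ) * Complex.I - Real.pi) by push_cast; ring,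
    sin_nat_mul_pi_add, Complex.sin_sub_pi, Complex.sin_mul_I, Complex.ofReal_sinh,
    mul_comm Complex.I, mul_neg]

lemma cos_N_sub_half_mul_cut (x : ℝ) :
    Complex.cos (((c.N : ℂ) - 1 / 2) * ((Real.pi : ℂ) + Complex.I * (x : ℂ))) =
      (-1) ^ c.N * (Complex.I * (Real.sinh (((c.N : ℝ) - 1 / 2) * x) : ℂ)) := by
  rw [show ((c.N : ℂ) - 1 / 2) * ((Real.pi : ℂ) + Complex.I * x) =
    (c.N : ℂ) * Real.pi + ((((c.N : ℝ) - 1 / 2) * x : ℝ) * Complex.I - Real.pi / 2) by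
      push_cast; ring,
    cos_nat_mul_pi_add, Complex.cos_sub_pi_div_two, Complex.sin_mul_I, Complex.ofReal_sinh,
    mul_comm Complex.I]

lemma norm_sq_resonance_cut (x : ℝ) :
    ‖c.resonance ((Real.pi : ℂ) + Complex.I * (x : ℂ))‖ ^ 2 = c.cutDenominator x := by
  have h : c.resonance ((Real.pi : ℂ) + Complex.I * (x : ℂ)) = (-1) ^ c.N * (Complex.I *
      (((Real.sinh ((c.N : ℝ) * x) - 4 * c.αL * c.αR * Real.sinh (((c.N : ℝ) - 1) * x) : ℝ) : ℂ)
      + ((2 * (c.αL + c.αR) * Real.sinh (((c.N : ℝ) - 1 / 2) * x) : ℝ) : ℂ) * Complex.I)) := by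
    rw [resonance, sin_N_mul_cut, sin_N_sub_one_mul_cut, cos_N_sub_half_mul_cut]
    push_cast
    ring
  rw [h]
  simp only [norm_mul, norm_pow, norm_neg, norm_one, one_pow, one_mul, Complex.norm_I]
  rw [Complex.sq_norm, Complex.normSq_add_mul_I, cutDenominator]
  ring

/-- The end-to-end transmission coefficient of the band is at most one. -/
lemma sixteen_mul_le_bandDenominator (φ : ℝ) :
    16 * (c.αL * c.αR) * Real.cos (φ / 2) ^ 2 ≤ c.bandDenominator φ := by
  have h1 : (c.N : ℝ) * φ = ((c.N : ℝ) - 1 / 2) * φ + φ / 2 := by ring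
  have h2 : ((c.N : ℝ) - 1) * φ = ((c.N : ℝ) - 1 / 2) * φ - φ / 2 := by ring
  rw [bandDenominator, h1, h2, Real.sin_add, Real.sin_sub]
  set y := ((c.N : ℝ) - 1 / 2) * φ
  have hy := Real.sin_sq_add_cos_sq y
  have hh := Real.sin_sq_add_cos_sq (φ / 2)
  set s := Real.sin y
  set C := Real.cos y
  set σ := Real.sin (φ / 2)
  set κ := Real.cos (φ / 2)
  set a := c.αL * c.αR with ha
  have hA : 16 * a * C ^ 2 ≤ 4 * (c.αL + c.αR) ^ 2 * C ^ 2 := by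
    refine mul_le_mul_of_nonneg_right ?_ (sq_nonneg C)
    nlinarith [sq_nonneg (c.αL - c.αR)]
  -- Swapping `1 + 4a` and `1 - 4a` between the two products changes the square by `16a(s²κ² - C²σ²)
  -- = 16a(κ² - C²)`. Together with `4αLαR ≤ (αL + αR)²` this is the bound.
  have key : (s * κ + C * σ + 4 * a * (s * κ - C * σ)) ^ 2 + 16 * a * C ^ 2 - 16 * a * κ ^ 2 =
      ((1 - 4 * a) * s * κ + (1 + 4 * a) * C * σ) ^ 2 := by
    have hσ : σ ^ 2 = 1 - κ ^ 2 := by linarith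
    have hs : s ^ 2 = 1 - C ^ 2 := by linarith
    linear_combination (16 * a * κ ^ 2) * hy - 16 * a * C ^ 2 * hh
  have h3 : 4 * c.αL * c.αR = 4 * a := by rw [ha]; ring
  rw [h3]
  nlinarith [sq_nonneg ((1 - 4 * a) * s * κ + (1 + 4 * a) * C * σ)]

lemma cos_half_pos {φ : ℝ} (hφ : φ ∈ Set.Ioo 0 Real.pi) : 0 < Real.cos (φ / 2) :=
  Real.cos_pos_of_mem_Ioo ⟨by linarith [hφ.1, Real.pi_pos], by linarith [hφ.2]⟩

lemma sin_half_pos {φ : ℝ} (hφ : φ ∈ Set.Ioo 0 Real.pi) : 0 < Real.sin (φ / 2) :=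
  Real.sin_pos_of_mem_Ioo ⟨by linarith [hφ.1], by linarith [hφ.2, Real.pi_pos]⟩

lemma bandDenominator_pos {φ : ℝ} (hφ : φ ∈ Set.Ioo 0 Real.pi) : 0 < c.bandDenominator φ := by
  have := cos_half_pos hφ
  have := c.αL_pos
  have := c.αR_pos
  exact lt_of_lt_of_le (by positivity) (c.sixteen_mul_le_bandDenominator φ)

/-- The second square alone suffices, since `N - 1/2 ≥ 1` gives `sinh((N - 1/2)ξ) ≥ sinh ξ`. The
factor `cosh²` provides the `1/ω²` decay of the transmission. -/
lemma le_cutDenominator {ξ : ℝ} (hξ : 0 < ξ) :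
    16 * (c.αL * c.αR) * (Real.cosh (ξ / 2) ^ 2 * Real.sinh (ξ / 2) ^ 2) ≤
      c.cutDenominator ξ := by
  have hN : (2 : ℝ) ≤ c.N := by exact_mod_cast c.two_le_N
  have hs : 0 < Real.sinh (ξ / 2) := Real.sinh_pos_iff.2 (by linarith)
  have hc : 1 ≤ Real.cosh (ξ / 2) := Real.one_le_cosh _
  have h1 : Real.cosh (ξ / 2) * Real.sinh (ξ / 2) ≤ Real.sinh (((c.N : ℝ) - 1 / 2) * ξ) := by
    have h2 : Real.sinh (2 * (ξ / 2)) ≤ Real.sinh (((c.N : ℝ) - 1 / 2) * ξ) :=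
      Real.sinh_le_sinh.2 (by nlinarith)
    rw [Real.sinh_two_mul] at h2
    nlinarith
  have h3 : (Real.cosh (ξ / 2) * Real.sinh (ξ / 2)) ^ 2 ≤
      Real.sinh (((c.N : ℝ) - 1 / 2) * ξ) ^ 2 := pow_le_pow_left₀ (by positivity) h1 2
  have hA : 16 * (c.αL * c.αR) ≤ 4 * (c.αL + c.αR) ^ 2 := by
    nlinarith [sq_nonneg (c.αL - c.αR)]
  have ha := mul_pos c.αL_pos c.αR_pos
  rw [← mul_pow]
  calc _ ≤ 4 * (c.αL + c.αR) ^ 2 * Real.sinh (((c.N : ℝ) - 1 / 2) * ξ) ^ 2 := by gcongr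
    _ ≤ c.cutDenominator ξ := by
      rw [cutDenominator]
      exact le_add_of_nonneg_left (sq_nonneg _)

lemma cutDenominator_pos {ξ : ℝ} (hξ : 0 < ξ) : 0 < c.cutDenominator ξ := by
  have hs : 0 < Real.sinh (ξ / 2) := Real.sinh_pos_iff.2 (by linarith)
  have hc := Real.cosh_pos (ξ / 2)
  have := c.αL_pos
  have := c.αR_pos
  exact lt_of_lt_of_le (by positivity) (c.le_cutDenominator hξ)

/-- The interval is open because `bandDenominator` vanishes at `φ = π`, and `φ = 0` is the singular
frequency. -/
lemma transmission_band {φ : ℝ} (hφ : φ ∈ Set.Ioo 0 Real.pi) :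
    c.transmission (2 * c.ω₀ * Real.sin (φ / 2)) =
      Real.cos (φ / 2) ^ 2 / (c.m ^ 2 * c.ω₀ ^ 2 * c.bandDenominator φ) := by
  have hB := c.bandDenominator_pos hφ
  have hr : c.resonance φ ≠ 0 := by
    intro h
    rw [← norm_sq_resonance_ofReal, h] at hB
    simp at hB
  have hω : 2 * c.ω₀ * Real.sin (φ / 2) ≠ 0 :=
    (mul_pos (mul_pos two_pos c.ω₀_pos) (sin_half_pos hφ)).ne'
  rw [c.transmission_eq (θ := φ) hω (by push_cast; ring) hr, norm_sq_resonance_ofReal]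
  congr 1
  rw [show (φ : ℂ) / 2 = ((φ / 2 : ℝ) : ℂ) by push_cast; ring, ← Complex.ofReal_cos,
    Complex.norm_real, Real.norm_eq_abs, sq_abs]

lemma transmission_cut {ξ : ℝ} (hξ : 0 < ξ) :
    c.transmission (2 * c.ω₀ * Real.cosh (ξ / 2)) =
      Real.sinh (ξ / 2) ^ 2 / (c.m ^ 2 * c.ω₀ ^ 2 * c.cutDenominator ξ) := by
  have hB := c.cutDenominator_pos hξ
  have hr : c.resonance ((Real.pi : ℂ) + Complex.I * (ξ : ℂ)) ≠ 0 := by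
    intro h
    rw [← norm_sq_resonance_cut, h] at hB
    simp at hB
  have hω : 2 * c.ω₀ * Real.cosh (ξ / 2) ≠ 0 :=
    (mul_pos (mul_pos two_pos c.ω₀_pos) (Real.cosh_pos _)).ne'
  rw [c.transmission_eq (θ := (Real.pi : ℂ) + Complex.I * (ξ : ℂ)) hω
    (by rw [sin_half_cut]; push_cast; ring) hr, norm_sq_resonance_cut, cos_half_cut]
  congr 1
  rw [norm_neg, norm_mul, Complex.norm_I, one_mul, Complex.norm_real, Real.norm_eq_abs, sq_abs]

/-! ### Frequency substitutions and integrability of the transmission -/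

lemma injOn_band : Set.InjOn (fun φ : ℝ => 2 * c.ω₀ * Real.sin (φ / 2)) (Set.Ioo 0 Real.pi) := by
  intro x hx y hy h
  have h1 := mul_left_cancel₀ (mul_pos two_pos c.ω₀_pos).ne' h
  have h2 := Real.injOn_sin ⟨by linarith [hx.1, Real.pi_pos], by linarith [hx.2]⟩
    ⟨by linarith [hy.1, Real.pi_pos], by linarith [hy.2]⟩ h1
  linarith

lemma image_band : (fun φ : ℝ => 2 * c.ω₀ * Real.sin (φ / 2)) '' Set.Ioo 0 Real.pi =
    Set.Ioo 0 (2 * c.ω₀) := by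
  have hw := c.ω₀_pos
  ext x
  constructor
  · rintro ⟨φ, hφ, rfl⟩
    have h1 := sin_half_pos hφ
    have h2 := cos_half_pos hφ
    have h3 : Real.sin (φ / 2) < 1 := by nlinarith [Real.sin_sq_add_cos_sq (φ / 2)]
    exact ⟨by positivity, by nlinarith⟩
  · rintro ⟨h0, h1⟩
    have h2 : 0 < x / (2 * c.ω₀) := by positivity
    have h3 : x / (2 * c.ω₀) < 1 := by rwa [div_lt_one (by positivity)]
    refine ⟨2 * Real.arcsin (x / (2 * c.ω₀)),
      ⟨by linarith [Real.arcsin_pos.2 h2], by linarith [Real.arcsin_lt_pi_div_two.2 h3]⟩, ?_⟩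
    simp only [mul_div_cancel_left₀ _ (two_ne_zero' ℝ)]
    rw [Real.sin_arcsin (by linarith) h3.le]
    field_simp

lemma injOn_cut : Set.InjOn (fun ξ : ℝ => 2 * c.ω₀ * Real.cosh (ξ / 2)) (Set.Ioi 0) := by
  intro x hx y hy h
  rw [Set.mem_Ioi] at hx hy
  have h1 := mul_left_cancel₀ (mul_pos two_pos c.ω₀_pos).ne' h
  have h2 := Real.cosh_strictMonoOn.injOn (show (0 : ℝ) ≤ x / 2 by positivity)
    (show (0 : ℝ) ≤ y / 2 by positivity) h1
  linarith

lemma image_cut : (fun ξ : ℝ => 2 * c.ω₀ * Real.cosh (ξ / 2)) '' Set.Ioi 0 =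
    Set.Ioi (2 * c.ω₀) := by
  have hw := c.ω₀_pos
  ext x
  constructor
  · rintro ⟨ξ, hξ, rfl⟩
    rw [Set.mem_Ioi] at hξ ⊢
    have : 1 < Real.cosh (ξ / 2) := Real.one_lt_cosh.2 (by positivity)
    nlinarith
  · intro hx
    rw [Set.mem_Ioi] at hx
    have h1 : 1 < x / (2 * c.ω₀) := by rwa [one_lt_div (by positivity)]
    refine ⟨2 * Real.arcosh (x / (2 * c.ω₀)), ?_, ?_⟩
    · rw [Set.mem_Ioi]
      linarith [Real.arcosh_pos h1]
    · simp only [mul_div_cancel_left₀ _ (two_ne_zero' ℝ)]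
      rw [Real.cosh_arcosh h1.le]
      field_simp

lemma ae_ne_and_abs_ne (a : ℝ) : ∀ᵐ ω : ℝ, ω ≠ 0 ∧ |ω| ≠ a := by
  have h : ∀ b : ℝ, ∀ᵐ ω : ℝ, ω ≠ b := fun b => compl_mem_ae_iff.2 (measure_singleton b)
  filter_upwards [h 0, h a, h (-a)] with ω h0 h1 h2
  refine ⟨h0, fun h3 => ?_⟩
  rcases abs_choice ω with h4 | h4
  · exact h1 (h4 ▸ h3)
  · exact h2 (by linarith)

lemma integrable_transmission : Integrable c.transmission := by
  have hm := c.m_pos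
  have hw := c.ω₀_pos
  have ha := mul_pos c.αL_pos c.αR_pos
  -- The two denominator bounds give transmission `≤ C` in the band and `≤ C / cosh²(ξ/2)` above it;
  -- the factor `1 + 4ω₀²` converts both into a multiple of `1/(1 + ω²)`.
  set C : ℝ := 1 / (16 * (c.αL * c.αR) * (c.m ^ 2 * c.ω₀ ^ 2)) with hC
  have hC0 : 0 < C := by positivity
  refine Integrable.mono' (integrable_inv_one_add_sq.const_mul (C * (1 + 4 * c.ω₀ ^ 2)))
    c.measurable_transmission.aestronglyMeasurable ?_
  have hpos : ∀ ω : ℝ, 0 < ω → ω ≠ 2 * c.ω₀ →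
      c.transmission ω ≤ C * (1 + 4 * c.ω₀ ^ 2) * (1 + ω ^ 2)⁻¹ := by
    intro ω h0 h1
    rw [← div_eq_mul_inv, le_div_iff₀ (by positivity)]
    rcases lt_or_gt_of_ne h1 with h | h
    · obtain ⟨φ, hφ, rfl⟩ : ω ∈ (fun φ : ℝ => 2 * c.ω₀ * Real.sin (φ / 2)) '' Set.Ioo 0 Real.pi := by
        rw [image_band]; exact ⟨h0, h⟩
      have hB := c.bandDenominator_pos hφ
      have h2 : c.transmission (2 * c.ω₀ * Real.sin (φ / 2)) ≤ C := by
        rw [c.transmission_band hφ, hC, div_le_div_iff₀ (by positivity) (by positivity)]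
        nlinarith [mul_le_mul_of_nonneg_right (c.sixteen_mul_le_bandDenominator φ)
          (by positivity : 0 ≤ c.m ^ 2 * c.ω₀ ^ 2)]
      have h3 : (2 * c.ω₀ * Real.sin (φ / 2)) ^ 2 ≤ 4 * c.ω₀ ^ 2 := by
        nlinarith [Real.sin_sq_le_one (φ / 2), sq_nonneg c.ω₀]
      exact mul_le_mul h2 (by linarith) (by positivity) hC0.le
    · obtain ⟨ξ, hξ, rfl⟩ : ω ∈ (fun ξ : ℝ => 2 * c.ω₀ * Real.cosh (ξ / 2)) '' Set.Ioi 0 := by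
        rw [image_cut]; exact h
      rw [Set.mem_Ioi] at hξ
      have hB := c.cutDenominator_pos hξ
      have hch : 1 ≤ Real.cosh (ξ / 2) ^ 2 := one_le_pow₀ (Real.one_le_cosh _)
      have h2 : c.transmission (2 * c.ω₀ * Real.cosh (ξ / 2)) * Real.cosh (ξ / 2) ^ 2 ≤ C := by
        rw [c.transmission_cut hξ, hC, div_mul_eq_mul_div,
          div_le_div_iff₀ (by positivity) (by positivity)]
        nlinarith [mul_le_mul_of_nonneg_right (c.le_cutDenominator hξ)
          (by positivity : 0 ≤ c.m ^ 2 * c.ω₀ ^ 2)]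
      have h3 : 1 + (2 * c.ω₀ * Real.cosh (ξ / 2)) ^ 2 ≤
          Real.cosh (ξ / 2) ^ 2 * (1 + 4 * c.ω₀ ^ 2) := by nlinarith
      calc _ ≤ c.transmission (2 * c.ω₀ * Real.cosh (ξ / 2)) *
            (Real.cosh (ξ / 2) ^ 2 * (1 + 4 * c.ω₀ ^ 2)) :=
            mul_le_mul_of_nonneg_left h3 (c.transmission_nonneg _)
        _ ≤ _ := by
          rw [← mul_assoc]
          exact mul_le_mul_of_nonneg_right h2 (by positivity)
  filter_upwards [ae_ne_and_abs_ne (2 * c.ω₀)] with ω hω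
  rw [Real.norm_of_nonneg (c.transmission_nonneg ω)]
  rcases lt_or_gt_of_ne hω.1 with h | h
  · rw [abs_of_neg h] at hω
    have := hpos (-ω) (by linarith) hω.2
    rwa [transmission_neg, neg_sq] at this
  · rw [abs_of_pos h] at hω
    exact hpos ω h hω.2

/-! ### Temperature dependence of the noise -/

/-- `ω coth (ħω / 2 k_B T)`. -/
noncomputable def thermalFactor (T ω : ℝ) : ℝ :=
  ω * (Real.cosh (c.ħ * ω / (2 * c.kB * T)) / Real.sinh (c.ħ * ω / (2 * c.kB * T)))

/-- The derivative of `ω coth (ħω / 2 k_B T)` with respect to `T`. -/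
noncomputable def thermalWeight (T ω : ℝ) : ℝ :=
  c.ħ / (2 * c.kB) * (ω / T) ^ 2 * (Real.sinh (c.ħ * ω / (2 * c.kB * T)))⁻¹ ^ 2

lemma hasDerivAt_thermalFactor {T : ℝ} (hT : T ≠ 0) (ω : ℝ) :
    HasDerivAt (fun T => c.thermalFactor T ω) (c.thermalWeight T ω) T := by
  have hk := c.kB_pos
  have hh := c.ħ_pos
  by_cases hω : ω = 0
  · subst hω
    simpa [thermalFactor, thermalWeight] using hasDerivAt_const T (0 : ℝ)
  have hs : Real.sinh (c.ħ * ω / (2 * c.kB * T)) ≠ 0 := by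
    rw [Real.sinh_ne_zero]
    positivity
  have hu : HasDerivAt (fun T => c.ħ * ω / (2 * c.kB * T))
      (-(c.ħ * ω / (2 * c.kB)) / T ^ 2) T := by
    have h := (hasDerivAt_inv hT).const_mul (c.ħ * ω / (2 * c.kB))
    refine (h.congr_deriv (by field_simp)).congr_of_eventuallyEq ?_
    refine Eventually.of_forall fun x => ?_
    simp only [div_eq_mul_inv, mul_inv]
    ring
  have h := ((hu.cosh.div hu.sinh hs).const_mul ω)
  refine h.congr_deriv ?_
  have hcs := Real.cosh_sq (c.ħ * ω / (2 * c.kB * T))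
  rw [thermalWeight]
  field_simp
  rw [mul_comm ω c.ħ]
  linarith

lemma thermalWeight_nonneg (T ω : ℝ) : 0 ≤ c.thermalWeight T ω := by
  have := c.kB_pos
  have := c.ħ_pos
  unfold thermalWeight
  positivity

/-- With `u = ħω/2k_BT` the weight is `(2k_B/ħ)(u / sinh u)²`, and `|u| ≤ |sinh u|`. -/
lemma thermalWeight_le {T : ℝ} (hT : T ≠ 0) (ω : ℝ) :
    c.thermalWeight T ω ≤ 2 * c.kB / c.ħ := by
  have hk := c.kB_pos
  have hh := c.ħ_pos
  set u := c.ħ * ω / (2 * c.kB * T) with hu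
  have h1 : c.thermalWeight T ω = 2 * c.kB / c.ħ * (u ^ 2 * (Real.sinh u)⁻¹ ^ 2) := by
    rw [thermalWeight, ← hu, ← mul_assoc]
    congr 1
    rw [hu]
    field_simp
  have h2 : u ^ 2 ≤ Real.sinh u ^ 2 := by
    rw [← sq_abs u, ← sq_abs (Real.sinh u), Real.abs_sinh]
    exact pow_le_pow_left₀ (abs_nonneg u) (Real.self_le_sinh_iff.2 (abs_nonneg u)) 2
  have h3 : u ^ 2 * (Real.sinh u)⁻¹ ^ 2 ≤ 1 := by
    rw [inv_pow, ← div_eq_mul_inv]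
    exact div_le_one_of_le₀ h2 (sq_nonneg _)
  rw [h1]
  exact mul_le_of_le_one_right (by positivity) h3

lemma thermalWeight_neg (T ω : ℝ) : c.thermalWeight T (-ω) = c.thermalWeight T ω := by
  simp only [thermalWeight, mul_neg, neg_div, Real.sinh_neg, inv_neg, neg_sq]

lemma measurable_thermalFactor (T : ℝ) : Measurable (c.thermalFactor T) := by
  unfold thermalFactor
  fun_prop

lemma measurable_thermalWeight (T : ℝ) : Measurable (c.thermalWeight T) := by
  unfold thermalWeight
  fun_prop

/-- Mean value inequality in `T`. Each factor grows like `|ω|`, but their difference stays bounded,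
so the `1/ω²` bound on the transmission is enough. -/
lemma abs_thermalFactor_sub_le {T T' : ℝ} (hT : 0 < T) (hT' : 0 < T') (ω : ℝ) :
    |c.thermalFactor T' ω - c.thermalFactor T ω| ≤ 2 * c.kB / c.ħ * |T' - T| := by
  refine (convex_Ioi (0 : ℝ)).norm_image_sub_le_of_norm_hasDerivWithin_le
    (f := fun T => c.thermalFactor T ω) (f' := fun T => c.thermalWeight T ω)
    (fun x hx => (c.hasDerivAt_thermalFactor (ne_of_gt hx) ω).hasDerivWithinAt)
    (fun x hx => ?_) hT hT'
  rw [Real.norm_of_nonneg (c.thermalWeight_nonneg x ω)]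
  exact c.thermalWeight_le (ne_of_gt hx) ω

/-! ### Landauer form of the flux and linear response -/

lemma heatFluxDensity_eq_transmission_mul (TL TR : ℝ) {ω : ℝ} (hω : ω ≠ 0) :
    c.heatFluxDensity TL TR ω = c.ηL * c.ηR * c.ħ *
      (c.transmission ω * (c.thermalFactor TL ω - c.thermalFactor TR ω)) := by
  rw [c.heatFluxDensity_eq TL TR hω, transmission, thermalFactor, thermalFactor, noiseSpectrum,
    noiseSpectrum]
  ring

lemma ae_heatFluxDensity_eq (TL TR : ℝ) : ∀ᵐ ω : ℝ, c.heatFluxDensity TL TR ω =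
    c.ηL * c.ηR * c.ħ *
      (c.transmission ω * (c.thermalFactor TL ω - c.thermalFactor TR ω)) := by
  filter_upwards [ae_ne_and_abs_ne 0] with ω hω
  exact c.heatFluxDensity_eq_transmission_mul TL TR hω.1

lemma integrable_heatFluxDensity {TL TR : ℝ} (hL : 0 < TL) (hR : 0 < TR) :
    Integrable (c.heatFluxDensity TL TR) := by
  refine Integrable.congr ?_ ((c.ae_heatFluxDensity_eq TL TR).mono fun _ h => h.symm)
  refine Integrable.const_mul ?_ _
  refine c.integrable_transmission.mul_bdd (c := 2 * c.kB / c.ħ * |TL - TR|)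
    ((c.measurable_thermalFactor TL).sub (c.measurable_thermalFactor TR)).aestronglyMeasurable ?_
  exact Eventually.of_forall fun ω => c.abs_thermalFactor_sub_le hR hL ω

lemma integrable_transmission_mul_thermalWeight {T : ℝ} (hT : T ≠ 0) :
    Integrable fun ω => c.transmission ω * c.thermalWeight T ω := by
  refine c.integrable_transmission.mul_bdd (c := 2 * c.kB / c.ħ)
    (c.measurable_thermalWeight T).aestronglyMeasurable ?_
  refine Eventually.of_forall fun ω => ?_
  rw [Real.norm_of_nonneg (c.thermalWeight_nonneg T ω)]
  exact c.thermalWeight_le hT ω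

lemma heatFlux_eq (TL TR : ℝ) : c.heatFlux TL TR = -((2 * Real.pi)⁻¹ * (c.ηL * c.ηR * c.ħ)) *
    ∫ ω, c.transmission ω * (c.thermalFactor TR ω - c.thermalFactor TL ω) := by
  rw [heatFlux, integral_congr_ae (c.ae_heatFluxDensity_eq TL TR), integral_const_mul, neg_mul,
    ← mul_neg, ← integral_neg]
  simp only [← mul_neg, neg_sub]
  ring

/-- Landauer form of the conductance. -/
lemma tendsto_heatFlux_div {T : ℝ} (hT : 0 < T) :
    Tendsto (fun ΔT : ℝ => c.heatFlux (T - ΔT / 2) (T + ΔT / 2) / (-ΔT)) (𝓝[≠] 0)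
      (𝓝 ((2 * Real.pi)⁻¹ * (c.ηL * c.ηR * c.ħ) *
        ∫ ω, c.transmission ω * c.thermalWeight T ω)) := by
  set F : ℝ → ℝ → ℝ := fun x ω =>
    c.transmission ω * (c.thermalFactor (T + x / 2) ω - c.thermalFactor (T - x / 2) ω) with hF
  set F' : ℝ → ℝ → ℝ := fun x ω => c.transmission ω *
    (c.thermalWeight (T + x / 2) ω * (1 / 2) + c.thermalWeight (T - x / 2) ω * (1 / 2)) with hF'
  have hmem : ∀ x ∈ Metric.ball (0 : ℝ) T, 0 < T + x / 2 ∧ 0 < T - x / 2 := by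
    intro x hx
    rw [mem_ball_zero_iff, Real.norm_eq_abs, abs_lt] at hx
    constructor <;> linarith [hx.1, hx.2]
  have hτ := c.measurable_transmission
  -- Since `F 0 = 0`, the conductance is a derivative at `0`. The ball of radius `T` keeps both
  -- temperatures positive, and the dominating function is independent of them.
  have main := (hasDerivAt_integral_of_dominated_loc_of_deriv_le (μ := volume) (F := F) (F' := F')
    (x₀ := (0 : ℝ)) (bound := fun ω => c.transmission ω * (2 * c.kB / c.ħ))
    (Metric.ball_mem_nhds (0 : ℝ) hT)
    (Eventually.of_forall fun x => (hτ.mul ((c.measurable_thermalFactor _).sub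
      (c.measurable_thermalFactor _))).aestronglyMeasurable)
    (by simp [hF])
    (hτ.mul (((c.measurable_thermalWeight _).mul_const _).add
      ((c.measurable_thermalWeight _).mul_const _))).aestronglyMeasurable
    (Eventually.of_forall fun ω x hx => ?_)
    (c.integrable_transmission.mul_const _)
    (Eventually.of_forall fun ω x hx => ?_)).2
  · rw [hasDerivAt_iff_tendsto_slope] at main
    have h0 : ∫ ω, F' 0 ω = ∫ ω, c.transmission ω * c.thermalWeight T ω := by
      refine integral_congr_ae (Eventually.of_forall fun ω => ?_)
      simp only [hF', zero_div, add_zero, sub_zero]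
      ring
    rw [h0] at main
    refine (main.const_mul ((2 * Real.pi)⁻¹ * (c.ηL * c.ηR * c.ħ))).congr fun x => ?_
    rw [heatFlux_eq, slope_def_field]
    simp only [hF, zero_div, add_zero, sub_zero, sub_self, mul_zero, integral_zero]
    rw [neg_mul, neg_div_neg_eq, mul_div_assoc]
  · obtain ⟨h1, h2⟩ := hmem x hx
    have h3 := c.thermalWeight_nonneg (T + x / 2) ω
    have h4 := c.thermalWeight_nonneg (T - x / 2) ω
    have h5 := c.transmission_nonneg ω
    rw [Real.norm_of_nonneg (by positivity)]
    refine mul_le_mul_of_nonneg_left ?_ h5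
    linarith [c.thermalWeight_le h1.ne' ω, c.thermalWeight_le h2.ne' ω]
  · obtain ⟨h1, h2⟩ := hmem x hx
    have h3 : HasDerivAt (fun x : ℝ => T + x / 2) (1 / 2) x :=
      ((hasDerivAt_id x).div_const 2).const_add T
    have h4 : HasDerivAt (fun x : ℝ => T - x / 2) (-(1 / 2)) x :=
      ((hasDerivAt_id x).div_const 2).const_sub T
    refine (((c.hasDerivAt_thermalFactor h1.ne' ω).comp x h3).sub
      ((c.hasDerivAt_thermalFactor h2.ne' ω).comp x h4)).const_mul (c.transmission ω)
      |>.congr_deriv ?_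
    simp only [hF']
    ring

/-! ### From the frequency integral to the two real integrals -/

/-- The constant relating the frequency integral to the integrals over `φ` and `ξ`. -/
noncomputable def conductancePrefactor (T : ℝ) : ℝ :=
  c.kB ^ 2 * c.debyeTemp / c.ħ * (c.αL * c.αR / c.reducedTemp T ^ 2)

lemma conductancePrefactor_eq {T : ℝ} (hT : T ≠ 0) : c.conductancePrefactor T =
    8 * c.ħ ^ 2 * c.ω₀ ^ 3 * (c.αL * c.αR) / (c.kB * T ^ 2) := by
  have := c.kB_pos
  have := c.ħ_pos
  have := c.ω₀_pos
  unfold conductancePrefactor reducedTemp debyeTemp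
  field_simp
  ring

lemma conductancePrefactor_pos {T : ℝ} (hT : 0 < T) : 0 < c.conductancePrefactor T := by
  have := c.kB_pos
  have := c.ħ_pos
  have := c.ω₀_pos
  have := c.αL_pos
  have := c.αR_pos
  rw [c.conductancePrefactor_eq hT.ne']
  positivity

lemma thermalWeight_two_mul {T : ℝ} (hT : T ≠ 0) (x : ℝ) :
    c.thermalWeight T (2 * c.ω₀ * x) = 2 * c.ħ * c.ω₀ ^ 2 / (c.kB * T ^ 2) * x ^ 2 *
      (Real.sinh (1 / (2 * c.reducedTemp T) * x))⁻¹ ^ 2 := by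
  have := c.kB_pos
  have := c.ħ_pos
  have := c.ω₀_pos
  have h : c.ħ * (2 * c.ω₀ * x) / (2 * c.kB * T) = 1 / (2 * c.reducedTemp T) * x := by
    unfold reducedTemp debyeTemp
    field_simp
  rw [thermalWeight, h]
  congr 1
  field_simp

/-- Spectral density of the conductance. -/
noncomputable def conductanceDensity (T ω : ℝ) : ℝ :=
  c.ηL * c.ηR * c.ħ * (c.transmission ω * c.thermalWeight T ω)

lemma conductanceDensity_band {T : ℝ} (hT : T ≠ 0) {φ : ℝ} (hφ : φ ∈ Set.Ioo 0 Real.pi) :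
    |c.ω₀ * Real.cos (φ / 2)| • c.conductanceDensity T (2 * c.ω₀ * Real.sin (φ / 2)) =
      c.conductancePrefactor T * c.bandIntegrand T φ := by
  have hk := c.kB_pos
  have hw := c.ω₀_pos
  have hm := c.m_pos
  have hB := c.bandDenominator_pos hφ
  have hc := cos_half_pos hφ
  rw [abs_of_pos (by positivity), smul_eq_mul, conductanceDensity, c.transmission_band hφ,
    c.thermalWeight_two_mul hT, c.conductancePrefactor_eq hT, bandIntegrand, ← bandDenominator,
    ηL_eq, ηR_eq]
  set S := (Real.sinh (1 / (2 * c.reducedTemp T) * Real.sin (φ / 2)))⁻¹ ^ 2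
  field_simp
  ring

lemma conductanceDensity_cut {T : ℝ} (hT : T ≠ 0) {ξ : ℝ} (hξ : ξ ∈ Set.Ioi (0 : ℝ)) :
    |c.ω₀ * Real.sinh (ξ / 2)| • c.conductanceDensity T (2 * c.ω₀ * Real.cosh (ξ / 2)) =
      c.conductancePrefactor T * c.cutIntegrand T ξ := by
  rw [Set.mem_Ioi] at hξ
  have hk := c.kB_pos
  have hw := c.ω₀_pos
  have hm := c.m_pos
  have hB := c.cutDenominator_pos hξ
  have hs : 0 < Real.sinh (ξ / 2) := Real.sinh_pos_iff.2 (by linarith)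
  rw [abs_of_pos (by positivity), smul_eq_mul, conductanceDensity, c.transmission_cut hξ,
    c.thermalWeight_two_mul hT, c.conductancePrefactor_eq hT, cutIntegrand, ← cutDenominator,
    ηL_eq, ηR_eq]
  set S := (Real.sinh (1 / (2 * c.reducedTemp T) * Real.cosh (ξ / 2)))⁻¹ ^ 2
  field_simp
  ring

lemma integrable_conductanceDensity {T : ℝ} (hT : T ≠ 0) :
    Integrable (c.conductanceDensity T) :=
  (c.integrable_transmission_mul_thermalWeight hT).const_mul _

lemma hasDerivAt_band (φ : ℝ) : HasDerivAt (fun φ : ℝ => 2 * c.ω₀ * Real.sin (φ / 2))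
    (c.ω₀ * Real.cos (φ / 2)) φ :=
  ((((hasDerivAt_id φ).div_const 2).sin).const_mul (2 * c.ω₀)).congr_deriv (by simp; ring)

lemma hasDerivAt_cut (ξ : ℝ) : HasDerivAt (fun ξ : ℝ => 2 * c.ω₀ * Real.cosh (ξ / 2))
    (c.ω₀ * Real.sinh (ξ / 2)) ξ :=
  ((((hasDerivAt_id ξ).div_const 2).cosh).const_mul (2 * c.ω₀)).congr_deriv (by simp; ring)

/-- Integrability is transported from the frequency side by the change of variables, so the
degenerate endpoint `φ = π` needs no separate estimate. -/
lemma integrableOn_bandIntegrand {T : ℝ} (hT : 0 < T) :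
    IntegrableOn (c.bandIntegrand T) (Set.Ioo 0 Real.pi) := by
  have h := (integrableOn_image_iff_integrableOn_abs_deriv_smul measurableSet_Ioo
    (fun φ _ => (c.hasDerivAt_band φ).hasDerivWithinAt) c.injOn_band (c.conductanceDensity T)).1
    (c.integrable_conductanceDensity hT.ne').integrableOn
  rw [integrableOn_congr_fun (fun φ hφ => c.conductanceDensity_band hT.ne' hφ)
    measurableSet_Ioo] at h
  exact (integrable_const_mul_iff (c.conductancePrefactor_pos hT).ne'.isUnit _).1 h

lemma integrableOn_cutIntegrand {T : ℝ} (hT : 0 < T) :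
    IntegrableOn (c.cutIntegrand T) (Set.Ioi 0) := by
  have h := (integrableOn_image_iff_integrableOn_abs_deriv_smul measurableSet_Ioi
    (fun ξ _ => (c.hasDerivAt_cut ξ).hasDerivWithinAt) c.injOn_cut (c.conductanceDensity T)).1
    (c.integrable_conductanceDensity hT.ne').integrableOn
  rw [integrableOn_congr_fun (fun ξ hξ => c.conductanceDensity_cut hT.ne' hξ)
    measurableSet_Ioi] at h
  exact (integrable_const_mul_iff (c.conductancePrefactor_pos hT).ne'.isUnit _).1 h

lemma intervalIntegrable_bandIntegrand {T : ℝ} (hT : 0 < T) :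
    IntervalIntegrable (c.bandIntegrand T) volume 0 Real.pi :=
  (intervalIntegrable_iff_integrableOn_Ioo_of_le Real.pi_pos.le).2 (c.integrableOn_bandIntegrand hT)

lemma conductanceDensity_neg (T ω : ℝ) :
    c.conductanceDensity T (-ω) = c.conductanceDensity T ω := by
  rw [conductanceDensity, conductanceDensity, transmission_neg, thermalWeight_neg]

lemma integral_conductanceDensity {T : ℝ} (hT : 0 < T) :
    ∫ ω, c.conductanceDensity T ω = 2 * c.conductancePrefactor T *
      ((∫ φ in (0 : ℝ)..Real.pi, c.bandIntegrand T φ)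
        + ∫ ξ in Set.Ioi (0 : ℝ), c.cutIntegrand T ξ) := by
  have hw := c.ω₀_pos
  have hint := c.integrable_conductanceDensity hT.ne'
  have h1 : ∫ ω, c.conductanceDensity T ω = 2 * ∫ ω in Set.Ioi 0, c.conductanceDensity T ω := by
    -- The density is even in `ω`, hence a function of `|ω|`.
    rw [← integral_comp_abs]
    refine integral_congr_ae (Eventually.of_forall fun ω => ?_)
    rcases abs_choice ω with h | h
    · simp only [h]
    · simp only [h, conductanceDensity_neg]
  have h2 : ∫ ω in Set.Ioi 0, c.conductanceDensity T ω =
      (∫ ω in Set.Ioo 0 (2 * c.ω₀), c.conductanceDensity T ω)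
        + ∫ ω in Set.Ioi (2 * c.ω₀), c.conductanceDensity T ω := by
    rw [← integral_Ioc_eq_integral_Ioo, ← setIntegral_union
      (Set.Ioc_disjoint_Ioi le_rfl) measurableSet_Ioi hint.integrableOn hint.integrableOn,
      Set.Ioc_union_Ioi_eq_Ioi (by positivity)]
  have h3 : ∫ ω in Set.Ioo 0 (2 * c.ω₀), c.conductanceDensity T ω =
      c.conductancePrefactor T * ∫ φ in (0 : ℝ)..Real.pi, c.bandIntegrand T φ := by
    rw [← c.image_band, integral_image_eq_integral_abs_deriv_smul measurableSet_Ioo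
      (fun φ _ => (c.hasDerivAt_band φ).hasDerivWithinAt) c.injOn_band,
      setIntegral_congr_fun measurableSet_Ioo fun φ hφ => c.conductanceDensity_band hT.ne' hφ,
      integral_const_mul, intervalIntegral.integral_of_le Real.pi_pos.le,
      integral_Ioc_eq_integral_Ioo]
  have h4 : ∫ ω in Set.Ioi (2 * c.ω₀), c.conductanceDensity T ω =
      c.conductancePrefactor T * ∫ ξ in Set.Ioi (0 : ℝ), c.cutIntegrand T ξ := by
    rw [← c.image_cut, integral_image_eq_integral_abs_deriv_smul measurableSet_Ioi
      (fun ξ _ => (c.hasDerivAt_cut ξ).hasDerivWithinAt) c.injOn_cut,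
      setIntegral_congr_fun measurableSet_Ioi fun ξ hξ => c.conductanceDensity_cut hT.ne' hξ,
      integral_const_mul]
  rw [h1, h2, h3, h4]
  ring

/-! ### The contour integral -/

lemma thetaIntegrand_neg (T : ℝ) (θ : ℂ) : c.thetaIntegrand T (-θ) = c.thetaIntegrand T θ := by
  simp only [thetaIntegrand, neg_div, mul_neg, Complex.sin_neg, Complex.cos_neg, Complex.sinh_neg,
    inv_neg, neg_sq]
  congr 2
  ring

lemma thetaIntegrand_ofReal (T φ : ℝ) :
    c.thetaIntegrand T φ = (c.bandIntegrand T φ : ℂ) := by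
  simp only [thetaIntegrand, bandIntegrand]
  push_cast
  rfl

/-- The cubed cosine contributes `(-i)³ = i`, and each square in the denominator contributes
`((-1)^N i)² = -1`. -/
lemma thetaIntegrand_cut (T x : ℝ) :
    c.thetaIntegrand T ((Real.pi : ℂ) + Complex.I * (x : ℂ)) =
      -(Complex.I * (c.cutIntegrand T x : ℂ)) := by
  simp only [thetaIntegrand, cutIntegrand, sin_half_cut, cos_half_cut, sin_N_mul_cut,
    sin_N_sub_one_mul_cut, cos_N_sub_half_mul_cut]
  push_cast
  have hs : ((-1 : ℂ) ^ c.N) ^ 2 = 1 := by rw [← pow_mul, mul_comm, pow_mul]; simp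
  set ε : ℂ := (-1 : ℂ) ^ c.N
  set P := Complex.sinh (c.N * x)
  set Q := Complex.sinh ((c.N - 1) * x)
  set R := Complex.sinh ((c.N - 1 / 2) * x)
  set S := (Complex.sinh (1 / (2 * (c.reducedTemp T : ℂ)) * Complex.cosh (x / 2)))⁻¹ ^ 2
  have hden : (ε * (Complex.I * P) + 4 * c.αL * c.αR * -(ε * (Complex.I * Q))) ^ 2
      + 4 * ((c.αL : ℂ) + c.αR) ^ 2 * (ε * (Complex.I * R)) ^ 2 =
      -((P - 4 * c.αL * c.αR * Q) ^ 2 + 4 * ((c.αL : ℂ) + c.αR) ^ 2 * R ^ 2) := by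
    have hI := Complex.I_sq
    linear_combination ((P - 4 * c.αL * c.αR * Q) ^ 2
      + 4 * ((c.αL : ℂ) + c.αR) ^ 2 * R ^ 2) * (Complex.I ^ 2 * hs + hI)
  rw [hden, div_neg, ← mul_div_assoc, neg_inj]
  congr 1
  have hI : Complex.I ^ 3 = -Complex.I := Complex.I_pow_three
  linear_combination -(Complex.cosh (x / 2) ^ 2 * Complex.sinh (x / 2) ^ 3 * S) * hI

lemma cutIntegrand_neg (T ξ : ℝ) : c.cutIntegrand T (-ξ) = -c.cutIntegrand T ξ := by
  simp only [cutIntegrand, neg_div, mul_neg, Real.sinh_neg, Real.cosh_neg]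
  rw [← neg_div]
  congr 1 <;> ring

lemma cutIntegrand_sign {s : ℝ} (hs : s = 1 ∨ s = -1) (T ξ : ℝ) :
    c.cutIntegrand T (s * ξ) = s * c.cutIntegrand T ξ := by
  rcases hs with rfl | rfl
  · simp
  · simp [cutIntegrand_neg]

lemma thetaIntegrand_rightArm {s : ℝ} (hs : s = 1 ∨ s = -1) (T ξ : ℝ) :
    c.thetaIntegrand T ((Real.pi : ℂ) + Complex.I * ((s * ξ : ℝ) : ℂ)) =
      -(Complex.I * s) * (c.cutIntegrand T ξ : ℂ) := by
  rw [thetaIntegrand_cut, c.cutIntegrand_sign hs]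
  push_cast
  ring

/-- Evenness in `θ` maps the left arm with sign `s` to the right arm with sign `-s`. -/
lemma thetaIntegrand_leftArm {s : ℝ} (hs : s = 1 ∨ s = -1) (T ξ : ℝ) :
    c.thetaIntegrand T (-(Real.pi : ℂ) + Complex.I * ((s * ξ : ℝ) : ℂ)) =
      (Complex.I * s) * (c.cutIntegrand T ξ : ℂ) := by
  rw [← thetaIntegrand_neg, show -(-(Real.pi : ℂ) + Complex.I * ((s * ξ : ℝ) : ℂ)) =
    (Real.pi : ℂ) + Complex.I * ((-s * ξ : ℝ) : ℂ) by push_cast; ring,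
    c.thetaIntegrand_rightArm (by rcases hs with rfl | rfl <;> simp)]
  push_cast
  ring

lemma bandIntegrand_neg (T φ : ℝ) : c.bandIntegrand T (-φ) = c.bandIntegrand T φ := by
  have h := c.thetaIntegrand_neg T φ
  rw [← Complex.ofReal_neg, thetaIntegrand_ofReal, thetaIntegrand_ofReal] at h
  exact_mod_cast h

lemma intervalIntegrable_bandIntegrand_neg {T : ℝ} (hT : 0 < T) :
    IntervalIntegrable (c.bandIntegrand T) volume (-Real.pi) 0 := by
  have h := (IntervalIntegrable.iff_comp_neg (f := c.bandIntegrand T)).1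
    (c.intervalIntegrable_bandIntegrand hT)
  simp only [bandIntegrand_neg, neg_zero] at h
  exact h.symm

lemma integral_bandIntegrand_symm {T : ℝ} (hT : 0 < T) :
    ∫ φ in (-Real.pi)..Real.pi, c.bandIntegrand T φ =
      2 * ∫ φ in (0 : ℝ)..Real.pi, c.bandIntegrand T φ := by
  have h := intervalIntegral.integral_comp_neg (a := 0) (b := Real.pi) (c.bandIntegrand T)
  simp only [bandIntegrand_neg, neg_zero] at h
  rw [← intervalIntegral.integral_add_adjacent_intervals
    (c.intervalIntegrable_bandIntegrand_neg hT) (c.intervalIntegrable_bandIntegrand hT), ← h,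
    two_mul]

lemma contourIntegrable_thetaIntegrand {T : ℝ} (hT : 0 < T) {s s' : ℝ} (hs : s = 1 ∨ s = -1)
    (hs' : s' = 1 ∨ s' = -1) : ContourIntegrable s s' (c.thetaIntegrand T) := by
  have hcut : IntegrableOn (fun ξ => (c.cutIntegrand T ξ : ℂ)) (Set.Ioi 0) :=
    (c.integrableOn_cutIntegrand hT).ofReal
  refine ⟨?_, ?_, ?_⟩
  · simp only [c.thetaIntegrand_leftArm hs]
    exact hcut.const_mul _
  · simp only [thetaIntegrand_ofReal]
    have h := (c.intervalIntegrable_bandIntegrand_neg hT).trans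
      (c.intervalIntegrable_bandIntegrand hT)
    exact ⟨h.1.ofReal, h.2.ofReal⟩
  · simp only [c.thetaIntegrand_rightArm hs']
    exact hcut.const_mul _

lemma contourIntegral_thetaIntegrand {T : ℝ} (hT : 0 < T) {s s' : ℝ} (hs : s = 1 ∨ s = -1)
    (hs' : s' = 1 ∨ s' = -1) : contourIntegral s s' (c.thetaIntegrand T) =
      ((2 * ((∫ φ in (0 : ℝ)..Real.pi, c.bandIntegrand T φ)
        + ∫ ξ in Set.Ioi (0 : ℝ), c.cutIntegrand T ξ) : ℝ) : ℂ) := by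
  have hsq : ∀ {r : ℝ}, r = 1 ∨ r = -1 → (r : ℂ) * r = 1 := by
    rintro r (rfl | rfl) <;> simp
  have hI := Complex.I_mul_I
  -- The minus sign obtained here is undone by the inward orientation of the left arm, so both arms
  -- contribute the cut integral with sign `+`.
  have hl : ∀ ξ : ℝ, (Complex.I * s) * (c.cutIntegrand T ξ : ℂ) * (Complex.I * (s : ℂ)) =
      -(c.cutIntegrand T ξ : ℂ) := fun ξ => by
    linear_combination (c.cutIntegrand T ξ : ℂ) * (s * s * hI - hsq hs)
  have hr : ∀ ξ : ℝ, -(Complex.I * s') * (c.cutIntegrand T ξ : ℂ) * (Complex.I * (s' : ℂ)) =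
      (c.cutIntegrand T ξ : ℂ) := fun ξ => by
    linear_combination -(c.cutIntegrand T ξ : ℂ) * (s' * s' * hI - hsq hs')
  simp only [contourIntegral, c.thetaIntegrand_leftArm hs, c.thetaIntegrand_rightArm hs',
    thetaIntegrand_ofReal, hl, hr, integral_neg, neg_neg, intervalIntegral.integral_ofReal,
    c.integral_bandIntegrand_symm hT]
  rw [integral_complex_ofReal]
  push_cast
  ring

end Chain

end HeatChain

theorem mainTheorem2 (c : HeatChain.Chain) (T : ℝ) (hT : 0 < T) :
    (∀ TL TR : ℝ, 0 < TL → 0 < TR → Integrable (c.heatFluxDensity TL TR)) ∧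
    ∃ K : ℝ,
      Tendsto (fun ΔT : ℝ => c.heatFlux (T - ΔT / 2) (T + ΔT / 2) / (-ΔT)) (𝓝[≠] 0) (𝓝 K) ∧
      (∀ s s' : ℝ, (s = 1 ∨ s = -1) → (s' = 1 ∨ s' = -1) →
        HeatChain.ContourIntegrable s s' (c.thetaIntegrand T) ∧
        (K : ℂ) =
          ((c.kB ^ 2 * c.debyeTemp / (2 * Real.pi * c.ħ)
            * (c.αL * c.αR / c.reducedTemp T ^ 2) : ℝ) : ℂ)
            * HeatChain.contourIntegral s s' (c.thetaIntegrand T)) ∧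
      IntervalIntegrable (c.bandIntegrand T) volume 0 Real.pi ∧
      IntegrableOn (c.cutIntegrand T) (Set.Ioi 0) ∧
      Real.pi * c.ħ * K / (c.kB ^ 2 * c.debyeTemp) =
        c.αL * c.αR / c.reducedTemp T ^ 2 *
          ((∫ φ in (0 : ℝ)..Real.pi, c.bandIntegrand T φ)
            + ∫ ξ in Set.Ioi (0 : ℝ), c.cutIntegrand T ξ) := by
  have hk := c.kB_pos
  have hh := c.ħ_pos
  have hD : 0 < c.debyeTemp := by
    have := c.ω₀_pos
    unfold HeatChain.Chain.debyeTemp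
    positivity
  have hπ := Real.pi_pos
  have hK : (2 * Real.pi)⁻¹ * (c.ηL * c.ηR * c.ħ) *
      ∫ ω, c.transmission ω * c.thermalWeight T ω =
      c.kB ^ 2 * c.debyeTemp / (Real.pi * c.ħ) * (c.αL * c.αR / c.reducedTemp T ^ 2) *
        ((∫ φ in (0 : ℝ)..Real.pi, c.bandIntegrand T φ)
          + ∫ ξ in Set.Ioi (0 : ℝ), c.cutIntegrand T ξ) := by
    have h := c.integral_conductanceDensity hT
    simp only [HeatChain.Chain.conductanceDensity, integral_const_mul] at h
    rw [mul_assoc, h, HeatChain.Chain.conductancePrefactor]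
    field_simp
  refine ⟨fun TL TR hL hR => c.integrable_heatFluxDensity hL hR, _, c.tendsto_heatFlux_div hT,
    fun s s' hs hs' => ⟨c.contourIntegrable_thetaIntegrand hT hs hs', ?_⟩,
    c.intervalIntegrable_bandIntegrand hT, c.integrableOn_cutIntegrand hT, ?_⟩
  · rw [c.contourIntegral_thetaIntegrand hT hs hs', ← Complex.ofReal_mul, hK]
    congr 1
    field_simp
  · rw [hK]
    field_simp
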